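/- A polynomial $f\in\mathbb{R}[x_1,\dots,x_n]$ is called multiaffine if it has degree at most one in each variable, and stable if $f(\mu)\neq 0$ for all $\mu\in\mathbb{C}^n$ with $\operatorname{Im}\mu_i>0$ for $i=1,\dots,n$. It has a definite determinantal representation if there are real symmetric matrices $M_1,\dots,M_n$ of some common size such that $f=\det(x_1M_1+\cdots+x_nM_n)$ and such that $e_1M_1+\cdots+e_nM_n$ is positive definite for some $e\in\mathbb{R}^n$ (the determinant of the $0\times 0$ matrix is $1$, and that matrix is positive definite). Let $1\le k\le n$ and let $f\in\mathbb{R}[x_1,\dots,x_n]$ be a multiaffine stable polynomial that has a definite determinantal representation. Then: 1. If $f|_{x_k=0}$ is not the zero polynomial, then it has a definite determinantal representation. 2. If $\frac{\partial f}{\partial x_k}$ is not the zero polynomial, then some nonzero real multiple $c\cdot\frac{\partial f}{\partial x_k}$ has a definite determinantal representation. 3. If $f(1,\dots,1)>0$ and $\frac{\partial f}{\partial x_k}$ is not constant, then $\frac{\partial f}{\partial x_k}$ itself has a definite determinantal representation (that is, one may take $c=1$ in 2). -/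

import Mathlib

/-- A real polynomial is multiaffine if its degree in each variable is at most one. -/
def IsMultiaffine {n : ℕ} (f : MvPolynomial (Fin n) ℝ) : Prop :=
  ∀ i, f.degreeOf i ≤ 1

/-- A real polynomial is stable if, as a complex polynomial, it does not vanish at any point
all of whose coordinates have positive imaginary part. -/
def IsStable {n : ℕ} (f : MvPolynomial (Fin n) ℝ) : Prop :=
  ∀ μ : Fin n → ℂ, (∀ i, 0 < (μ i).im) → MvPolynomial.aeval μ f ≠ 0

/-- The matrix of linear forms `x₁ M₁ + ⋯ + xₙ Mₙ`. -/
noncomputable def linearPencil {n d : ℕ} (M : Fin n → Matrix (Fin d) (Fin d) ℝ) :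
    Matrix (Fin d) (Fin d) (MvPolynomial (Fin n) ℝ) :=
  ∑ i, (MvPolynomial.X i : MvPolynomial (Fin n) ℝ) • (M i).map MvPolynomial.C

/-- `f` has a definite determinantal representation: `f = det (x₁ M₁ + ⋯ + xₙ Mₙ)` with real
symmetric matrices `Mᵢ` such that `e₁ M₁ + ⋯ + eₙ Mₙ` is positive definite for some real `e`.
(The size `d` of the matrices is then necessarily the degree of `f`.) -/
def HasDefiniteDetRep {n : ℕ} (f : MvPolynomial (Fin n) ℝ) : Prop :=
  ∃ (d : ℕ) (M : Fin n → Matrix (Fin d) (Fin d) ℝ), (∀ i, (M i).IsSymm) ∧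
    (∃ e : Fin n → ℝ, (∑ i, e i • M i).PosDef) ∧ f = (linearPencil M).det

/-- The deletion `f|_{x_k = 0}`, as a polynomial in the same variables. -/
noncomputable def deletion {n : ℕ} (k : Fin n) (f : MvPolynomial (Fin n) ℝ) :
    MvPolynomial (Fin n) ℝ :=
  MvPolynomial.aeval (Function.update MvPolynomial.X k 0) f

/-! ### Evaluating multiaffine polynomials and linear pencils -/

open Matrix

/-! Diagonalize `M k` against the positive definite `P = ∑ eᵢ Mᵢ` by a congruence `W`. Along `e +
t·e_k` the determinant is, up to `det W ^ 2`, `∏ (1 + t lⱼ)`; as it is affine in `t`, `M k` has rank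
at most one, so each `s i • M i` is semidefinite for some sign `s i`. Semidefiniteness survives
replacing `M k` by `0` (deletion) and passing to a principal submatrix (derivative). A nonzero
determinant then gives definiteness back.

For part 3, stability makes `f` nonnegative on the nonnegative orthant, which forces `f(s·x) =
f(x)`. All matrices may thus be taken semidefinite, so the constant in the derivative is positive
and can be absorbed by scaling. -/

theorem eval_update_eq_of_degreeOf_le_one {n : ℕ} {f : MvPolynomial (Fin n) ℝ} {k : Fin n}
    (hf : f.degreeOf k ≤ 1) (x : Fin n → ℝ) (t : ℝ) :
    MvPolynomial.eval (Function.update x k t) f =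
      MvPolynomial.eval (Function.update x k 0) f +
        t * MvPolynomial.eval x (MvPolynomial.pderiv k f) := by
  have key : ∀ m ∈ f.support,
      MvPolynomial.eval (Function.update x k t) (MvPolynomial.monomial m (f.coeff m)) =
      MvPolynomial.eval (Function.update x k 0) (MvPolynomial.monomial m (f.coeff m)) +
        t * MvPolynomial.eval x
          (MvPolynomial.pderiv k (MvPolynomial.monomial m (f.coeff m))) := by
    intro m hm
    have hk : m k ≤ 1 := (MvPolynomial.monomial_le_degreeOf k hm).trans hf
    have hprod : ∀ (y : ℝ), ∏ i, Function.update x k y i ^ m i =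
        y ^ m k * ∏ i ∈ Finset.univ.erase k, x i ^ m i := by
      intro y
      rw [← Finset.mul_prod_erase _ _ (Finset.mem_univ k), Function.update_self]
      congr 1
      refine Finset.prod_congr rfl fun i hi => ?_
      rw [Function.update_of_ne (Finset.ne_of_mem_erase hi)]
    have hprod' : ∏ i, x i ^ (m - Finsupp.single k 1 : Fin n →₀ ℕ) i =
        ∏ i ∈ Finset.univ.erase k, x i ^ m i := by
      rw [← Finset.mul_prod_erase _ _ (Finset.mem_univ k)]
      have : (m - Finsupp.single k 1 : Fin n →₀ ℕ) k = 0 := by simp; omega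
      rw [this, pow_zero, one_mul]
      refine Finset.prod_congr rfl fun i hi => ?_
      simp [Finsupp.single_eq_of_ne (Finset.ne_of_mem_erase hi)]
    rw [MvPolynomial.pderiv_monomial]
    simp only [MvPolynomial.eval_monomial, Finsupp.prod_fintype _ _ (fun i => pow_zero _),
      hprod, hprod']
    interval_cases m k
    · simp
    · simp; ring
  conv_lhs => rw [f.as_sum]
  conv_rhs => rw [f.as_sum]
  simp only [map_sum, Finset.mul_sum, ← Finset.sum_add_distrib]
  exact Finset.sum_congr rfl key

theorem eval_deletion {n : ℕ} (k : Fin n) (f : MvPolynomial (Fin n) ℝ) (x : Fin n → ℝ) :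
    MvPolynomial.eval x (deletion k f) = MvPolynomial.eval (Function.update x k 0) f := by
  have h : Function.update x k 0 =
      fun i => MvPolynomial.eval x (Function.update MvPolynomial.X k 0 i) := by
    funext i
    rcases eq_or_ne i k with rfl | hi
    · simp
    · simp [hi]
  rw [h, deletion, ← MvPolynomial.coe_aeval_eq_eval, ← MvPolynomial.coe_aeval_eq_eval]
  simp only [RingHom.coe_coe]
  rw [← AlgHom.comp_apply, MvPolynomial.comp_aeval]

theorem eval_det_linearPencil {n d : ℕ} (M : Fin n → Matrix (Fin d) (Fin d) ℝ) (x : Fin n → ℝ) :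
    MvPolynomial.eval x (linearPencil M).det = (∑ i, x i • M i).det := by
  rw [RingHom.map_det]
  congr 1
  ext a b
  simp [linearPencil, Matrix.sum_apply]

theorem isHomogeneous_det_linearPencil {n d : ℕ} (M : Fin n → Matrix (Fin d) (Fin d) ℝ) :
    (linearPencil M).det.IsHomogeneous d := by
  rw [Matrix.det_apply]
  refine MvPolynomial.IsHomogeneous.sum _ _ _ fun σ _ => ?_
  have h : (∏ i, linearPencil M (σ i) i).IsHomogeneous (∑ _i : Fin d, 1) := by
    refine MvPolynomial.IsHomogeneous.prod _ _ _ fun i _ => ?_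
    simp only [linearPencil, Matrix.sum_apply, Matrix.smul_apply, Matrix.map_apply, smul_eq_mul]
    refine MvPolynomial.IsHomogeneous.sum _ _ _ fun j _ => ?_
    exact (MvPolynomial.isHomogeneous_X _ j).mul (MvPolynomial.isHomogeneous_C _ _)
  rw [Finset.sum_const, Finset.card_univ, Fintype.card_fin, smul_eq_mul, mul_one] at h
  rcases Int.units_eq_one_or (Equiv.Perm.sign σ) with hs | hs <;> rw [hs]
  · simpa using h
  · simpa using h.neg

/-! ### Congruence, definiteness and scaling -/

theorem Matrix.PosDef.exists_transpose_mul_mul_eq_one {d : ℕ} {P : Matrix (Fin d) (Fin d) ℝ}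
    (hP : P.PosDef) : ∃ S : Matrix (Fin d) (Fin d) ℝ, Sᵀ * P * S = 1 := by
  open scoped MatrixOrder in
  obtain ⟨B, hB, rfl⟩ :=
    CStarAlgebra.isStrictlyPositive_iff_eq_star_mul_self.mp hP.isStrictlyPositive
  have hu : IsUnit B.det := (Matrix.isUnit_iff_isUnit_det B).mp hB
  refine ⟨B⁻¹, ?_⟩
  rw [Matrix.star_eq_conjTranspose, Matrix.conjTranspose_eq_transpose_of_trivial,
    Matrix.transpose_nonsing_inv, ← Matrix.mul_assoc,
    Matrix.nonsing_inv_mul _ (by rwa [Matrix.det_transpose]), Matrix.one_mul,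
    Matrix.mul_nonsing_inv _ hu]

theorem Matrix.PosDef.exists_simultaneous_diagonalization {d : ℕ} {P M : Matrix (Fin d) (Fin d) ℝ}
    (hP : P.PosDef) (hM : M.IsSymm) : ∃ (W : Matrix (Fin d) (Fin d) ℝ) (l : Fin d → ℝ),
      Wᵀ * P * W = 1 ∧ Wᵀ * M * W = Matrix.diagonal l := by
  obtain ⟨S, hS⟩ := hP.exists_transpose_mul_mul_eq_one
  have hH : (Sᵀ * M * S).IsHermitian := by
    rw [Matrix.IsHermitian, Matrix.conjTranspose_eq_transpose_of_trivial]
    simp [Matrix.transpose_mul, hM.eq, Matrix.mul_assoc]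
  set U : Matrix (Fin d) (Fin d) ℝ := (hH.eigenvectorUnitary : Matrix (Fin d) (Fin d) ℝ) with hU
  have hUU : Uᵀ * U = 1 := by
    have := Unitary.coe_star_mul_self hH.eigenvectorUnitary
    rwa [← hU, Matrix.star_eq_conjTranspose,
      Matrix.conjTranspose_eq_transpose_of_trivial] at this
  have hdiag : Uᵀ * (Sᵀ * M * S) * U = Matrix.diagonal hH.eigenvalues := by
    have := hH.conjStarAlgAut_star_eigenvectorUnitary
    rw [Unitary.conjStarAlgAut_star_apply, ← hU, Matrix.star_eq_conjTranspose,
      Matrix.conjTranspose_eq_transpose_of_trivial] at this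
    simpa using this
  refine ⟨S * U, hH.eigenvalues, ?_, ?_⟩
  · calc (S * U)ᵀ * P * (S * U) = Uᵀ * (Sᵀ * P * S) * U := by
          simp only [Matrix.transpose_mul, Matrix.mul_assoc]
      _ = 1 := by rw [hS, Matrix.mul_one, hUU]
  · rw [← hdiag]
    simp only [Matrix.transpose_mul, Matrix.mul_assoc]

/-- If `∏ (1 + t lⱼ)` is an affine function of `t`, at most one `lⱼ` is nonzero. -/
theorem eq_of_prod_one_add_mul_affine {d : ℕ} {l : Fin d → ℝ} {b c : ℝ}
    (h : ∀ t : ℝ, ∏ j, (1 + t * l j) = b + t * c) {i j : Fin d} (hi : l i ≠ 0) (hj : l j ≠ 0) :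
    i = j := by
  classical
  by_contra hij
  open Polynomial in
  have hp : ∏ j, (C (l j) * X + C 1) = C c * X + C b := by
    refine Polynomial.funext fun t => ?_
    rw [Polynomial.eval_prod]
    simp only [eval_add, eval_mul, eval_C, eval_X]
    rw [show c * t + b = b + t * c by ring, ← h t]
    exact Finset.prod_congr rfl fun j _ => by ring
  have hdeg := congrArg Polynomial.natDegree hp
  rw [Polynomial.natDegree_prod _ _ (fun j _ h0 => by
    simpa using congrArg (Polynomial.eval 0) h0)] at hdeg
  have h1 : ∀ j, l j ≠ 0 →
      (Polynomial.C (l j) * Polynomial.X + Polynomial.C 1).natDegree = 1 :=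
    fun j hj => Polynomial.natDegree_linear hj
  have h2 := Finset.sum_le_sum_of_subset (f := fun j =>
    (Polynomial.C (l j) * Polynomial.X + Polynomial.C 1).natDegree)
    (Finset.subset_univ ({i, j} : Finset (Fin d)))
  rw [hdeg, Finset.sum_pair hij, h1 i hi, h1 j hj] at h2
  have h3 := Polynomial.natDegree_linear_le (a := c) (b := b)
  omega

theorem Matrix.det_add_single {d : ℕ} (A : Matrix (Fin (d + 1)) (Fin (d + 1)) ℝ)
    (j : Fin (d + 1)) (c : ℝ) :
    (A + Matrix.single j j c).det = A.det + c * (A.submatrix j.succAbove j.succAbove).det := by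
  have h1 : A + Matrix.single j j c = A.updateRow j (A j + c • Pi.single j 1) := by
    ext a b
    rcases eq_or_ne a j with rfl | ha
    · rcases eq_or_ne b a with rfl | hb
      · simp
      · simp [hb, hb.symm]
    · simp [Matrix.updateRow_ne ha, ha.symm]
  rw [h1, Matrix.det_updateRow_add, Matrix.updateRow_eq_self, Matrix.det_updateRow_smul,
    ← Matrix.adjugate_apply, Matrix.adjugate_fin_succ_eq_det_submatrix]
  simp [← two_mul]

/-- A vector isotropic for a sum of semidefinite matrices lies in every kernel, so it would make the
pencil singular at every point. -/
theorem Matrix.posDef_sum_smul_of_det_linearPencil_ne_zero {n d : ℕ}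
    {M : Fin n → Matrix (Fin d) (Fin d) ℝ} {s : Fin n → ℝ} (hs : ∀ i, s i ≠ 0)
    (hM : ∀ i, (s i • M i).PosSemidef) (hdet : (linearPencil M).det ≠ 0) :
    (∑ i, s i • M i).PosDef := by
  obtain ⟨x, hx⟩ : ∃ x, MvPolynomial.eval x (linearPencil M).det ≠ 0 := by
    by_contra! h
    exact hdet (MvPolynomial.funext fun x => by rw [h x, map_zero])
  rw [eval_det_linearPencil] at hx
  have hsum : (∑ i, s i • M i).PosSemidef := Matrix.posSemidef_sum _ fun i _ => hM i
  refine .of_dotProduct_mulVec_pos hsum.1 fun v hv => ?_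
  refine lt_of_le_of_ne (hsum.dotProduct_mulVec_nonneg v) fun h0 => hx ?_
  rw [Matrix.sum_mulVec, dotProduct_sum, eq_comm,
    Finset.sum_eq_zero_iff_of_nonneg fun i _ => (hM i).dotProduct_mulVec_nonneg v] at h0
  refine Matrix.exists_mulVec_eq_zero_iff.mp ⟨v, hv, ?_⟩
  rw [Matrix.sum_mulVec]
  refine Finset.sum_eq_zero fun i hi => ?_
  have h1 := ((hM i).dotProduct_mulVec_zero_iff v).mp (h0 i hi)
  rw [Matrix.smul_mulVec, smul_eq_zero_iff_right (hs i)] at h1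
  rw [Matrix.smul_mulVec, h1, smul_zero]

theorem hasDefiniteDetRep_det_linearPencil {n d : ℕ}
    {M : Fin n → Matrix (Fin d) (Fin d) ℝ} {s : Fin n → ℝ} (hs : ∀ i, s i ≠ 0)
    (hM : ∀ i, (s i • M i).PosSemidef) (hdet : (linearPencil M).det ≠ 0) :
    HasDefiniteDetRep (linearPencil M).det := by
  refine ⟨d, M, fun i => ?_, ⟨s, posDef_sum_smul_of_det_linearPencil_ne_zero hs hM hdet⟩, rfl⟩
  have h := (hM i).1
  rw [Matrix.IsHermitian, Matrix.conjTranspose_eq_transpose_of_trivial, Matrix.transpose_smul] at h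
  exact smul_right_injective _ (hs i) h

/-- Each matrix absorbs a `d`-th root of `c`; positive degree excludes `d = 0`. -/
theorem HasDefiniteDetRep.smul {n : ℕ} {f : MvPolynomial (Fin n) ℝ} (hf : HasDefiniteDetRep f)
    (hdeg : 0 < f.totalDegree) {c : ℝ} (hc : 0 < c) : HasDefiniteDetRep (c • f) := by
  obtain ⟨d, M, hM, ⟨e, he⟩, rfl⟩ := hf
  have hd : d ≠ 0 := by
    rintro rfl
    simp at hdeg
  have hr : 0 < c ^ (d : ℝ)⁻¹ := Real.rpow_pos_of_pos hc _
  refine ⟨d, fun i => c ^ (d : ℝ)⁻¹ • M i, fun i => ?_, ⟨e, ?_⟩, ?_⟩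
  · rw [Matrix.IsSymm, Matrix.transpose_smul, (hM i).eq]
  · simp_rw [smul_comm _ (c ^ (d : ℝ)⁻¹), ← Finset.smul_sum]
    exact he.smul hr
  · refine MvPolynomial.funext fun x => ?_
    rw [MvPolynomial.smul_eval, eval_det_linearPencil, eval_det_linearPencil]
    simp_rw [smul_comm _ (c ^ (d : ℝ)⁻¹), ← Finset.smul_sum]
    rw [Matrix.det_smul, Fintype.card_fin, Real.rpow_inv_natCast_pow hc.le hd]

/-! ### Coefficient matrices of rank at most one -/

theorem exists_diagonalization_of_degreeOf_le_one {n d : ℕ} {M : Fin n → Matrix (Fin d) (Fin d) ℝ}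
    {e : Fin n → ℝ} (he : (∑ i, e i • M i).PosDef) {k : Fin n} (hM : (M k).IsSymm)
    (hk : (linearPencil M).det.degreeOf k ≤ 1) :
    ∃ (W : Matrix (Fin d) (Fin d) ℝ) (l : Fin d → ℝ), W.det ≠ 0 ∧
      Wᵀ * M k * W = Matrix.diagonal l ∧ ∀ i j, l i ≠ 0 → l j ≠ 0 → i = j := by
  obtain ⟨W, l, h1, h2⟩ := he.exists_simultaneous_diagonalization hM
  refine ⟨W, l, fun h0 => ?_, h2, ?_⟩
  · simpa [h0] using congrArg Matrix.det h1
  set f := (linearPencil M).det with hf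
  refine fun i j => eq_of_prod_one_add_mul_affine
    -- Coefficients of `f` at `e` with `k`-th entry `e k + t`, times the factor from the congruence.
    (b := W.det ^ 2 * (MvPolynomial.eval (Function.update e k 0) f +
      e k * MvPolynomial.eval e (MvPolynomial.pderiv k f)))
    (c := W.det ^ 2 * MvPolynomial.eval e (MvPolynomial.pderiv k f)) fun t => ?_
  have h3 := eval_update_eq_of_degreeOf_le_one hk e (e k + t)
  have h4 : ∑ i, Function.update e k (e k + t) i • M i = ∑ i, e i • M i + t • M k := by
    rw [← Finset.add_sum_erase _ _ (Finset.mem_univ k),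
      ← Finset.add_sum_erase (a := k) _ (fun i => e i • M i) (Finset.mem_univ k),
      Function.update_self, add_smul, add_right_comm]
    congr 2
    refine Finset.sum_congr rfl fun i hi => ?_
    rw [Function.update_of_ne (Finset.ne_of_mem_erase hi)]
  rw [hf, eval_det_linearPencil, h4, ← hf] at h3
  have h5 : Wᵀ * (∑ i, e i • M i + t • M k) * W = Matrix.diagonal fun j => 1 + t * l j := by
    rw [Matrix.mul_add, Matrix.add_mul, h1, Matrix.mul_smul, Matrix.smul_mul, h2,
      ← Matrix.diagonal_one, ← Matrix.diagonal_smul, Matrix.diagonal_add]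
    rfl
  have h6 := congrArg Matrix.det h5
  rw [Matrix.det_mul, Matrix.det_mul, Matrix.det_transpose, Matrix.det_diagonal, h3] at h6
  rw [← h6]
  ring

theorem exists_sign_smul_posSemidef {d : ℕ} {A W : Matrix (Fin d) (Fin d) ℝ} {l : Fin d → ℝ}
    (hW : W.det ≠ 0) (hA : Wᵀ * A * W = Matrix.diagonal l)
    (hl : ∀ i j, l i ≠ 0 → l j ≠ 0 → i = j) :
    ∃ s : ℝ, (s = 1 ∨ s = -1) ∧ (s • A).PosSemidef := by
  have hu : IsUnit W.det := hW.isUnit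
  have hA' : ∀ s : ℝ, s • A = W⁻¹ᵀ * Matrix.diagonal (s • l) * W⁻¹ := by
    intro s
    have ht : W⁻¹ᵀ * Wᵀ = 1 := by
      rw [← Matrix.transpose_mul, Matrix.mul_nonsing_inv _ hu, Matrix.transpose_one]
    rw [Matrix.diagonal_smul, ← hA, Matrix.mul_smul, Matrix.smul_mul]
    congr 1
    calc A = (W⁻¹ᵀ * Wᵀ) * A * (W * W⁻¹) := by
          rw [ht, Matrix.mul_nonsing_inv _ hu, Matrix.one_mul, Matrix.mul_one]
      _ = _ := by simp only [Matrix.mul_assoc]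
  have key : ∀ s : ℝ, 0 ≤ s • l → (s • A).PosSemidef := by
    intro s h
    rw [hA', ← Matrix.conjTranspose_eq_transpose_of_trivial]
    exact (Matrix.PosSemidef.diagonal h).conjTranspose_mul_mul_same _
  by_cases h : ∃ j, l j < 0
  · obtain ⟨j, hj⟩ := h
    refine ⟨-1, .inr rfl, key _ fun i => ?_⟩
    rcases eq_or_ne (l i) 0 with hi | hi
    · simp [hi]
    · rw [hl i j hi hj.ne]
      simpa using hj.le
  · push Not at h
    exact ⟨1, .inl rfl, key _ fun i => by simpa using h i⟩

/-- After congruence `M k` is supported on one diagonal entry `(j, j)`, so differentiating deletes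
row and column `j`. -/
theorem exists_pderiv_det_linearPencil {n d : ℕ} {M : Fin n → Matrix (Fin d) (Fin d) ℝ}
    {s : Fin n → ℝ} (hM : ∀ i, (s i • M i).PosSemidef) {k : Fin n}
    {W : Matrix (Fin d) (Fin d) ℝ} {l : Fin d → ℝ} (hW : W.det ≠ 0)
    (hA : Wᵀ * M k * W = Matrix.diagonal l) (hl : ∀ i j, l i ≠ 0 → l j ≠ 0 → i = j)
    (hk : (linearPencil M).det.degreeOf k ≤ 1) :
    ∃ (m : ℕ) (c : ℝ) (N : Fin n → Matrix (Fin m) (Fin m) ℝ),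
      MvPolynomial.pderiv k (linearPencil M).det = c • (linearPencil N).det ∧
      (∀ i, (s i • N i).PosSemidef) ∧ ((M k).PosSemidef → 0 ≤ c) := by
  rcases d with - | d
  · exact ⟨0, 0, M, by simp, hM, fun _ => le_rfl⟩
  obtain ⟨j, hj⟩ : ∃ j, Matrix.diagonal l = Matrix.single j j (l j) := by
    by_cases h : ∃ j, l j ≠ 0
    · obtain ⟨j, hj⟩ := h
      refine ⟨j, ?_⟩
      rw [← Matrix.diagonal_single]
      congr 1
      funext i
      rcases eq_or_ne i j with rfl | hij
      · simp
      · rw [Pi.single_eq_of_ne hij]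
        by_contra hi
        exact hij (hl i j hi hj)
    · push Not at h
      obtain rfl : l = 0 := funext h
      exact ⟨0, by simp⟩
  have hN : ∀ i, Wᵀ * (s i • M i) * W = s i • (Wᵀ * M i * W) := fun i => by
    rw [Matrix.mul_smul, Matrix.smul_mul]
  refine ⟨d, (W.det ^ 2)⁻¹ * l j,
    fun i => (Wᵀ * M i * W).submatrix j.succAbove j.succAbove, ?_, fun i => ?_, fun h => ?_⟩
  · refine MvPolynomial.funext fun x => ?_
    have h0 := eval_update_eq_of_degreeOf_le_one hk x 1
    rw [eval_det_linearPencil, eval_det_linearPencil, one_mul] at h0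
    rw [MvPolynomial.smul_eval, eval_det_linearPencil]
    -- Setting `x k` to `0` is harmless: the congruent image of `M k` vanishes off row `j`, hence on
    -- the minor.
    set A := ∑ i, Function.update x k 0 i • M i with hA0
    have h1 : ∑ i, Function.update x k 1 i • M i = A + M k := by
      rw [hA0, ← Finset.add_sum_erase _ _ (Finset.mem_univ k),
        ← Finset.add_sum_erase (a := k) _ (fun i => Function.update x k 0 i • M i)
          (Finset.mem_univ k), Function.update_self, Function.update_self, one_smul, zero_smul,
        zero_add, add_comm (M k)]
      congr 1
      refine Finset.sum_congr rfl fun i hi => ?_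
      rw [Function.update_of_ne (Finset.ne_of_mem_erase hi),
        Function.update_of_ne (Finset.ne_of_mem_erase hi)]
    have h2 : ∑ i, x i • (Wᵀ * M i * W).submatrix j.succAbove j.succAbove =
        (Wᵀ * A * W).submatrix j.succAbove j.succAbove := by
      rw [hA0, Matrix.mul_sum, Matrix.sum_mul]
      ext a b
      simp only [Matrix.sum_apply, Matrix.submatrix_apply, Matrix.smul_apply, Matrix.mul_smul,
        Matrix.smul_mul]
      refine Finset.sum_congr rfl fun i _ => ?_
      rcases eq_or_ne i k with rfl | hi
      · rw [hA, hj, Matrix.single_apply_of_row_ne (Fin.succAbove_ne j a).symm]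
        simp
      · rw [Function.update_of_ne hi]
    have h3 := Matrix.det_add_single (Wᵀ * A * W) j (l j)
    rw [← hj, ← hA, ← Matrix.add_mul, ← Matrix.mul_add, ← h2] at h3
    simp only [Matrix.det_mul, Matrix.det_transpose] at h3
    rw [h1] at h0
    rw [h0] at h3
    field_simp
    linear_combination h3
  · have h := ((hM i).conjTranspose_mul_mul_same W).submatrix j.succAbove
    rw [Matrix.conjTranspose_eq_transpose_of_trivial, hN] at h
    exact h
  · have h1 := h.conjTranspose_mul_mul_same W
    rw [Matrix.conjTranspose_eq_transpose_of_trivial, hA, Matrix.posSemidef_diagonal_iff] at h1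
    exact mul_nonneg (by positivity) (h1 j)

/-! ### Signs of values and coefficients -/

theorem MvPolynomial.IsHomogeneous.sum_eq_of_mem_support {n d : ℕ} {f : MvPolynomial (Fin n) ℝ}
    (hh : f.IsHomogeneous d) {m : Fin n →₀ ℕ} (hm : m ∈ f.support) : ∑ i, m i = d := by
  rw [hh.degree_eq_sum_deg_support hm]
  exact (Finset.sum_subset (Finset.subset_univ _) fun i _ hi => by simpa using hi).symm

/-- By homogeneity `f(i·y) = i^d f(y)`, so `f` has no zero in the open orthant; a negative value at
`x` would produce one on the segment from `x` to the all-ones point. -/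
theorem IsStable.eval_nonneg {n d : ℕ} {f : MvPolynomial (Fin n) ℝ} (hst : IsStable f)
    (hh : f.IsHomogeneous d) (h1 : 0 < MvPolynomial.eval (fun _ => (1 : ℝ)) f) {x : Fin n → ℝ}
    (hx : ∀ i, 0 ≤ x i) : 0 ≤ MvPolynomial.eval x f := by
  have hpos : ∀ y : Fin n → ℝ, (∀ i, 0 < y i) → MvPolynomial.eval y f ≠ 0 := by
    intro y hy h0
    refine hst (fun i => Complex.I * y i) (fun i => by simpa using hy i) ?_
    have h2 : MvPolynomial.aeval (fun i => (y i : ℂ)) f = ((MvPolynomial.eval y f : ℝ) : ℂ) := by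
      have := MvPolynomial.aeval_algebraMap_apply (A := ℝ) ℂ y f
      simpa [Function.comp_def] using this
    have h3 : MvPolynomial.aeval (fun i => Complex.I * y i) f =
        Complex.I ^ d * MvPolynomial.aeval (fun i => (y i : ℂ)) f := by
      rw [MvPolynomial.aeval_def, MvPolynomial.aeval_def, MvPolynomial.eval₂_eq',
        MvPolynomial.eval₂_eq', Finset.mul_sum]
      refine Finset.sum_congr rfl fun m hm => ?_
      simp only [mul_pow, Finset.prod_mul_distrib, Finset.prod_pow_eq_pow_sum,
        hh.sum_eq_of_mem_support hm]
      ring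
    rw [h3, h2, h0, Complex.ofReal_zero, mul_zero]
  by_contra! hneg
  let g : ℝ → ℝ := fun t => MvPolynomial.eval (fun i => (1 - t) * x i + t) f
  have hg : Continuous g := by
    have : Continuous fun t : ℝ => (fun i => (1 - t) * x i + t : Fin n → ℝ) := by fun_prop
    exact (MvPolynomial.continuous_eval f).comp this
  have hg0 : g 0 < 0 := by simpa [g] using hneg
  have hg1 : 0 < g 1 := by simpa [g] using h1
  obtain ⟨t, ht, hgt⟩ := intermediate_value_Ioo (zero_le_one (α := ℝ)) hg.continuousOn ⟨hg0, hg1⟩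
  refine hpos _ (fun i => ?_) hgt
  have := mul_nonneg (sub_nonneg.mpr ht.2.le) (hx i)
  linarith [ht.1]

/-- Any other squarefree monomial of the same degree contains a variable outside `m`, which is set
to zero. -/
theorem eval_indicator_of_isHomogeneous {n d : ℕ} {f : MvPolynomial (Fin n) ℝ}
    (hma : IsMultiaffine f) (hh : f.IsHomogeneous d) {m : Fin n →₀ ℕ} (hm : m ∈ f.support)
    (z : Fin n → ℝ) :
    MvPolynomial.eval (fun i => (m i : ℝ) * z i) f = f.coeff m * ∏ i, z i ^ m i := by
  have hle : ∀ m' ∈ f.support, ∀ i, m' i ≤ 1 := fun m' h i =>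
    (MvPolynomial.monomial_le_degreeOf i h).trans (hma i)
  rw [MvPolynomial.eval_eq', Finset.sum_eq_single_of_mem m hm]
  · congr 1
    refine Finset.prod_congr rfl fun i _ => ?_
    have := hle m hm i
    interval_cases m i <;> simp
  · intro m' hm' hne
    obtain ⟨i, hi⟩ : ∃ i, m i < m' i := by
      by_contra! h
      refine hne (Finsupp.ext fun i => ?_)
      exact (Finset.sum_eq_sum_iff_of_le fun i _ => h i).mp
        ((hh.sum_eq_of_mem_support hm').trans (hh.sum_eq_of_mem_support hm).symm) i (Finset.mem_univ i)
    have h0 : m i = 0 := by have := hle m' hm' i; omega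
    rw [Finset.prod_eq_zero (Finset.mem_univ i), mul_zero]
    rw [h0, Nat.cast_zero, zero_mul, zero_pow (by omega)]

/-- Indicator points isolate the coefficients: `h1` makes each one in the support positive, and `h2`
then rules out `∏ sᵢ ^ mᵢ = -1`. -/
theorem eval_sign_mul_eq {n d : ℕ} {f : MvPolynomial (Fin n) ℝ}
    (hma : IsMultiaffine f) (hh : f.IsHomogeneous d) {s : Fin n → ℝ}
    (hs : ∀ i, s i = 1 ∨ s i = -1) (h1 : ∀ x : Fin n → ℝ, (∀ i, 0 ≤ x i) →
      0 ≤ MvPolynomial.eval x f)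
    (h2 : ∀ x : Fin n → ℝ, (∀ i, 0 ≤ x i) → 0 ≤ MvPolynomial.eval (fun i => x i * s i) f)
    (x : Fin n → ℝ) : MvPolynomial.eval (fun i => x i * s i) f = MvPolynomial.eval x f := by
  rw [MvPolynomial.eval_eq', MvPolynomial.eval_eq']
  refine Finset.sum_congr rfl fun m hm => ?_
  have e1 := h1 (fun i => (m i : ℝ) * 1) fun i => by positivity
  have e2 := h2 (fun i => (m i : ℝ)) fun i => by positivity
  rw [eval_indicator_of_isHomogeneous hma hh hm] at e1 e2
  have hc : 0 < f.coeff m :=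
    lt_of_le_of_ne (by simpa using e1) (MvPolynomial.mem_support_iff.mp hm).symm
  have hsq : (∏ i, s i ^ m i) ^ 2 = 1 := by
    rw [← Finset.prod_pow]
    refine Finset.prod_eq_one fun i _ => ?_
    rcases hs i with h | h <;> simp [h, ← pow_mul, mul_comm]
  have hprod : ∏ i, s i ^ m i = 1 := by
    rcases eq_or_eq_neg_of_sq_eq_sq (∏ i, s i ^ m i) 1 (hsq.trans (one_pow 2).symm) with h | h
    · exact h
    · rw [h] at e2
      linarith
  simp only [mul_pow, Finset.prod_mul_distrib, hprod, mul_one]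

/-! ### Deletion and derivative -/

theorem mainTheorem12 {n : ℕ} (k : Fin n) (f : MvPolynomial (Fin n) ℝ)
    (hma : IsMultiaffine f) (hst : IsStable f) (hdet : HasDefiniteDetRep f) :
    (deletion k f ≠ 0 → HasDefiniteDetRep (deletion k f)) ∧
    (MvPolynomial.pderiv k f ≠ 0 →
      ∃ c : ℝ, c ≠ 0 ∧ HasDefiniteDetRep (c • MvPolynomial.pderiv k f)) ∧
    (0 < MvPolynomial.eval (fun _ => (1 : ℝ)) f → 0 < (MvPolynomial.pderiv k f).totalDegree →
      HasDefiniteDetRep (MvPolynomial.pderiv k f)) := by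
  obtain ⟨d, M, hM, ⟨e, he⟩, rfl⟩ := hdet
  have hsign : ∀ i, ∃ s : ℝ, (s = 1 ∨ s = -1) ∧ (s • M i).PosSemidef := fun i => by
    obtain ⟨W, l, hW, hA, hl⟩ := exists_diagonalization_of_degreeOf_le_one he (hM i) (hma i)
    exact exists_sign_smul_posSemidef hW hA hl
  choose s hs hMs using hsign
  have hs0 : ∀ i, s i ≠ 0 := fun i => by rcases hs i with h | h <;> simp [h]
  refine ⟨fun h0 => ?_, fun h0 => ?_, fun h1 hdeg => ?_⟩
  · have hdel : deletion k (linearPencil M).det =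
        (linearPencil (Function.update M k 0)).det := by
      refine MvPolynomial.funext fun x => ?_
      rw [eval_deletion, eval_det_linearPencil, eval_det_linearPencil]
      congr 1
      refine Finset.sum_congr rfl fun i _ => ?_
      rcases eq_or_ne i k with rfl | hi
      · simp
      · simp [hi]
    rw [hdel] at h0 ⊢
    refine hasDefiniteDetRep_det_linearPencil hs0 (fun i => ?_) h0
    rcases eq_or_ne i k with rfl | hi
    · simpa using Matrix.PosSemidef.zero
    · simpa [hi] using hMs i
  · obtain ⟨W, l, hW, hA, hl⟩ := exists_diagonalization_of_degreeOf_le_one he (hM k) (hma k)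
    obtain ⟨m, c, N, hN, hNs, -⟩ := exists_pderiv_det_linearPencil hMs hW hA hl (hma k)
    rw [hN] at h0 ⊢
    have hc : c ≠ 0 := left_ne_zero_of_smul h0
    refine ⟨c⁻¹, inv_ne_zero hc, ?_⟩
    rw [smul_smul, inv_mul_cancel₀ hc, one_smul]
    exact hasDefiniteDetRep_det_linearPencil hs0 hNs (right_ne_zero_of_smul h0)
  · have hev : ∀ x : Fin n → ℝ, MvPolynomial.eval (fun i => x i * s i) (linearPencil M).det =
        (∑ i, x i • (s i • M i)).det := fun x => by
      simp only [eval_det_linearPencil, smul_smul]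
    have heq : (linearPencil M).det = (linearPencil fun i => s i • M i).det := by
      refine MvPolynomial.funext fun x => ?_
      rw [eval_det_linearPencil (fun i => s i • M i), ← hev]
      refine (eval_sign_mul_eq hma (isHomogeneous_det_linearPencil M) hs (fun y hy =>
        hst.eval_nonneg (isHomogeneous_det_linearPencil M) h1 hy) (fun y hy => ?_) x).symm
      rw [hev]
      exact (Matrix.posSemidef_sum _ fun i _ => (hMs i).smul (hy i)).det_nonneg
    have hdet0 : (linearPencil M).det ≠ 0 := fun h => by simp [h] at h1
    -- From here all signs are `1`, and the all-ones vector is a definite direction.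
    rw [heq] at hma hdet0 hdeg ⊢
    have hMs' : ∀ i, ((1 : ℝ) • (s i • M i)).PosSemidef := fun i => by simpa using hMs i
    have hone : ∀ _ : Fin n, (1 : ℝ) ≠ 0 := fun _ => one_ne_zero
    obtain ⟨W, l, hW, hA, hl⟩ := exists_diagonalization_of_degreeOf_le_one
      (posDef_sum_smul_of_det_linearPencil_ne_zero hone hMs' hdet0) (k := k)
      (by rw [Matrix.IsSymm, Matrix.transpose_smul, (hM k).eq]) (hma k)
    obtain ⟨m, c, N, hN, hNs, hc⟩ := exists_pderiv_det_linearPencil hMs' hW hA hl (hma k)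
    rw [hN] at hdeg ⊢
    have hne : c • (linearPencil N).det ≠ 0 := fun h => by simp [h] at hdeg
    have hcpos : 0 < c := (hc (hMs k)).lt_of_ne (left_ne_zero_of_smul hne).symm
    exact (hasDefiniteDetRep_det_linearPencil hone hNs (right_ne_zero_of_smul hne)).smul
      (hdeg.trans_le (MvPolynomial.totalDegree_smul_le c _)) hcpos
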